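/- Let $n>k\ge r\ge 1$ be integers. An $(n,k,r)$-LRC is a linear code $C\subseteq\mathbb F^n$ of dimension $k$ over a finite field $\mathbb F$ such that every coordinate of the codewords of $C$ is a (fixed) linear combination of at most $r$ other coordinates. Assume that at least one $(n,k,r)$-LRC exists, and let $\mathscr D(n,k,r)$ be the largest minimum (Hamming) distance among all $(n,k,r)$-LRCs, over all finite fields. Put $$k_1=\left\lceil \tfrac{k}{r}\right\rceil,\quad k_2=k_1 r-k,\quad n_1=\left\lceil \tfrac{n}{r+1}\right\rceil,\quad n_2=n_1(r+1)-n,\quad d^*=n-k-\left\lceil \tfrac{k}{r}\right\rceil+2 .$$ Suppose $k_1=3$ and $k_2=2$. Then $$\mathscr D(n,k,r)=d^*\quad\text{if and only if}\quad n_2\le\left\lfloor \frac{n_1^2}{4}\right\rfloor .$$ -/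

import Mathlib

namespace LRC

/-- The minimum distance of a code `C` of length `n`: the minimum Hamming distance between two
distinct codewords. -/
noncomputable def minDist {F : Type*} [Field F] [DecidableEq F] {n : ℕ}
    (C : Submodule F (Fin n → F)) : ℕ :=
  sInf {d : ℕ | ∃ x ∈ C, ∃ y ∈ C, x ≠ y ∧ hammingDist x y = d}

/-- `C` is an `(n, k, r)`-locally recoverable code: a linear code of length `n` and dimension `k`
in which every coordinate of a codeword is a fixed linear combination of at most `r` other
coordinates (all-symbol locality `r`). -/
structure IsLRC {F : Type*} [Field F] (n k r : ℕ) (C : Submodule F (Fin n → F)) : Prop where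
  finrank_eq : Module.finrank F C = k
  locality : ∀ i : Fin n, ∃ R : Finset (Fin n), i ∉ R ∧ R.card ≤ r ∧
    ∃ a : Fin n → F, ∀ x ∈ C, x i = ∑ j ∈ R, a j * x j

open Classical in
/-- The set of minimum distances of `(n, k, r)`-LRCs, over all finite fields. -/
def minDistSet (n k r : ℕ) : Set ℕ :=
  {d : ℕ | ∃ (F : Type) (_ : Field F) (_ : Finite F) (C : Submodule F (Fin n → F)),
    IsLRC n k r C ∧ minDist C = d}

/-- `𝒟(n, k, r)`: the largest minimum distance among all `(n, k, r)`-LRCs, with no restriction on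
the order of the finite field. -/
noncomputable def largestMinDist (n k r : ℕ) : ℕ := sSup (minDistSet n k r)

theorem minDist_le {F : Type*} [Field F] [DecidableEq F] {n : ℕ}
    (C : Submodule F (Fin n → F)) : minDist C ≤ n := by
  unfold minDist
  rcases Set.eq_empty_or_nonempty
    {d : ℕ | ∃ x ∈ C, ∃ y ∈ C, x ≠ y ∧ hammingDist x y = d} with h | h
  · rw [h]; simp
  · obtain ⟨x, -, y, -, -, hd⟩ := Nat.sInf_mem h
    rw [← hd]
    simpa using hammingDist_le_card_fintype (x := x) (y := y)

/-- As soon as some `(n, k, r)`-LRC exists, `𝒟(n, k, r)` is a genuine maximum. -/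
theorem isGreatest_largestMinDist {n k r : ℕ} (h : (minDistSet n k r).Nonempty) :
    IsGreatest (minDistSet n k r) (largestMinDist n k r) := by
  have hb : BddAbove (minDistSet n k r) := by
    refine ⟨n, ?_⟩
    rintro d ⟨F, _, _, C, -, rfl⟩
    classical exact minDist_le C
  exact ⟨Nat.sSup_mem h hb, fun d hd => le_csSup hb hd⟩

/-- `k₁ = ⌈k / r⌉`. -/
def k₁ (k r : ℕ) : ℤ := ⌈(k : ℚ) / (r : ℚ)⌉

/-- `k₂ = k₁ r - k`. -/
def k₂ (k r : ℕ) : ℤ := k₁ k r * r - k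

/-- `n₁ = ⌈n / (r + 1)⌉`. -/
def n₁ (n r : ℕ) : ℤ := ⌈(n : ℚ) / ((r : ℚ) + 1)⌉

/-- `n₂ = n₁ (r + 1) - n`. -/
def n₂ (n r : ℕ) : ℤ := n₁ n r * (r + 1) - n

/-- `d* = n - k - ⌈k / r⌉ + 2`. -/
def dStar (n k r : ℕ) : ℤ := n - k - ⌈(k : ℚ) / (r : ℚ)⌉ + 2

end LRC

/-! The hypotheses amount to `k + 2 = 3 * r` and `3 ≤ r`, so d* = n - k - 1. Write m = n₁ and s =
n₂; the criterion reads 4s ≤ m².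

Upper bound. `cardAddFinrank C U` is k plus the nullity of U, the number of independent relations
among the coordinates in U. Choosing repair groups greedily, each at a coordinate not yet covered,
gives m groups in which any t have a union of nullity at least t (`IsLRC.exists_repair_groups`). The
generalized Singleton bound (`minDist_add_cardAddFinrank_le`) applied to two groups gives d ≤ n - k
- 1. If equality holds, no nonzero codeword vanishes on three groups, so their union has at least k
+ 3 = 3(r + 1) - 2 elements. A Mantel-type argument (`mul_card_le_card_biUnion_add_sq`) then shows
that all m groups together lose at most m²/4 to overlaps and missing elements, whence s ≤ m²/4.

Construction. Let the groups be the vertices of a bipartite graph with s edges; each edge is a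
coordinate shared by its two ends, and private coordinates fill every group up to r + 1. Requiring
each group to sum to zero defines a code C₀. Any 3r coordinates support at most a two-dimensional
space of these checks (`IsBipartiteArrangement.finrank_rowsSupportedIn_le`), so over a large field a
generic k-dimensional subcode of C₀ has no nonzero word with 3r zeros, and d ≥ n - 3r + 1 = n - k -
1. -/

namespace LRC

/-! ### Unions of sets with small overlaps -/

/-- If every three of the sets `Γ i`, of size at most `q`, have a union of size at least `3q - 2`,
then the union of `m ≥ 3` of them has size at least `mq - m²/4`. -/
theorem mul_card_le_card_biUnion_add_sq {ι α : Type*} [DecidableEq ι] [DecidableEq α]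
    (Γ : ι → Finset α) (q : ℕ) (hq : ∀ i, (Γ i).card ≤ q) (S : Finset ι) (hS : 3 ≤ S.card)
    (htriple : ∀ T ⊆ S, T.card = 3 → 3 * q ≤ (T.biUnion Γ).card + 2) :
    4 * (S.card * q) ≤ 4 * (S.biUnion Γ).card + S.card ^ 2 := by
  induction hm : S.card using Nat.strong_induction_on generalizing S with
  | _ m ih =>
  subst hm
  -- overlap of a pair with the remaining sets
  have key : ∀ i ∈ S, ∀ j ∈ S, i ≠ j → ∀ δ : ℕ, 2 * q ≤ (Γ i ∪ Γ j).card + δ →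
      (Γ i ∪ Γ j).card + δ ≤ 2 * q → δ ≤ 2 ∧
      (((S.erase i).erase j).biUnion Γ).card + 2 * q ≤
        (S.biUnion Γ).card + δ + (S.card - 2) * (2 - δ) := by
    intro i hi j hj hij δ h1 h2
    have hj' : j ∈ S.erase i := Finset.mem_erase.2 ⟨hij.symm, hj⟩
    have hc : ((S.erase i).erase j).card = S.card - 2 := by
      rw [Finset.card_erase_of_mem hj', Finset.card_erase_of_mem hi]; omega
    have hl : ∀ l ∈ (S.erase i).erase j,
        δ ≤ 2 ∧ (Γ l ∩ (Γ i ∪ Γ j)).card ≤ 2 - δ := by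
      intro l hl
      simp only [Finset.mem_erase, ne_eq] at hl
      have h3 := htriple {l, i, j} (by
        intro x hx
        simp only [Finset.mem_insert, Finset.mem_singleton] at hx
        rcases hx with rfl | rfl | rfl <;> tauto)
        (Finset.card_eq_three.2 ⟨l, i, j, hl.2.1, hl.1, hij, rfl⟩)
      have h4 : ({l, i, j} : Finset ι).biUnion Γ = Γ l ∪ (Γ i ∪ Γ j) := by
        ext; simp
      rw [h4] at h3
      have h5 := Finset.card_union_add_card_inter (Γ l) (Γ i ∪ Γ j)
      have h6 := hq l
      omega
    have hne : ((S.erase i).erase j).Nonempty := by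
      rw [← Finset.card_pos]; omega
    refine ⟨(hl _ hne.choose_spec).1, ?_⟩
    have hu : S.biUnion Γ = ((S.erase i).erase j).biUnion Γ ∪ (Γ i ∪ Γ j) := by
      conv_lhs => rw [← Finset.insert_erase hi, ← Finset.insert_erase hj']
      ext; simp only [Finset.biUnion_insert, Finset.mem_union]; tauto
    have hint : (((S.erase i).erase j).biUnion Γ ∩ (Γ i ∪ Γ j)).card ≤
        (S.card - 2) * (2 - δ) := by
      rw [Finset.biUnion_inter, ← hc]
      exact Finset.card_biUnion_le_card_mul _ _ _ fun l h => (hl l h).2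
    have h5 := Finset.card_union_add_card_inter (((S.erase i).erase j).biUnion Γ) (Γ i ∪ Γ j)
    rw [← hu] at h5
    omega
  have hpair_le : ∀ i j, (Γ i ∪ Γ j).card ≤ 2 * q := fun i j =>
    (Finset.card_union_le _ _).trans (by have := hq i; have := hq j; omega)
  have hcard : ∀ i ∈ S, ∀ j ∈ S, i ≠ j → ((S.erase i).erase j).card = S.card - 2 := by
    intro i hi j hj hij
    rw [Finset.card_erase_of_mem (Finset.mem_erase.2 ⟨hij.symm, hj⟩),
      Finset.card_erase_of_mem hi]
    omega
  have hsub : ∀ i j, (S.erase i).erase j ⊆ S := fun i j =>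
    (Finset.erase_subset _ _).trans (Finset.erase_subset _ _)
  rcases eq_or_ne S.card 3 with h3 | h3
  · have := htriple S subset_rfl h3
    rw [h3]; omega
  by_cases hall : ∀ i ∈ S, ∀ j ∈ S, i ≠ j → (Γ i ∪ Γ j).card = 2 * q
  · have hcq : ∀ i ∈ S, (Γ i).card = q := by
      intro i hi
      obtain ⟨j, hj, hji⟩ := Finset.exists_mem_ne (by omega : 1 < S.card) i
      have := hall i hi j hj hji.symm
      have := Finset.card_union_le (Γ i) (Γ j)
      have := hq i; have := hq j
      omega
    have hdisj : ∀ i ∈ S, ∀ j ∈ S, i ≠ j → Disjoint (Γ i) (Γ j) := by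
      intro i hi j hj hij
      rw [Finset.disjoint_iff_inter_eq_empty, ← Finset.card_eq_zero]
      have := Finset.card_union_add_card_inter (Γ i) (Γ j)
      have := hall i hi j hj hij
      have := hcq i hi; have := hcq j hj
      omega
    rw [Finset.card_biUnion hdisj, Finset.sum_const_nat hcq]
    omega
  push Not at hall
  obtain ⟨i₀, hi₀, j₀, hj₀, hij₀, h₀⟩ := hall
  -- the bound after removing a pair of defect `1` or `2`
  have step : ∀ i ∈ S, ∀ j ∈ S, i ≠ j → 5 ≤ S.card → (Γ i ∪ Γ j).card ≠ 2 * q →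
      4 * (S.card * q) ≤ 4 * (S.biUnion Γ).card + S.card ^ 2 := by
    intro i hi j hj hij h5 hne
    obtain ⟨hδ, hk⟩ := key i hi j hj hij (2 * q - (Γ i ∪ Γ j).card) (by omega)
      (by have := hpair_le i j; omega)
    have hle := hpair_le i j
    have hih := ih (S.card - 2) (by omega) ((S.erase i).erase j)
      (by rw [hcard i hi j hj hij]; omega)
      (fun T hT => htriple T (hT.trans (hsub i j))) (hcard i hi j hj hij)
    obtain ⟨c, hc⟩ : ∃ c, S.card = c + 2 := ⟨S.card - 2, by omega⟩
    generalize hδ' : 2 * q - (Γ i ∪ Γ j).card = δ at *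
    rw [hc] at hih hk ⊢
    rw [Nat.add_sub_cancel] at hih hk
    -- Removing the pair costs δ + (m - 2)(2 - δ), which is m - 1 or 2, while the allowance m²/4 -
    -- (m - 2)²/4 equals m - 1.
    have : δ = 1 ∨ δ = 2 := by omega
    rcases this with rfl | rfl
    · nlinarith
    · rw [Nat.sub_self, mul_zero] at hk
      nlinarith
  rcases le_or_gt 5 S.card with h5 | h5
  · exact step i₀ hi₀ j₀ hj₀ hij₀ h5 h₀
  -- Removing a pair from four sets leaves two, below the range of the induction. The loss is
  -- bounded by 4 directly: 2 + 2 if some pair has defect 2, otherwise 1 + 2 · 1 + 1.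
  have h4 : S.card = 4 := by omega
  have hpair : ∀ i ∈ S, ∀ j ∈ S, i ≠ j → ∃ i' ∈ S, ∃ j' ∈ S, i' ≠ j' ∧
      ((S.erase i).erase j).biUnion Γ = Γ i' ∪ Γ j' := by
    intro i hi j hj hij
    have h2 : ((S.erase i).erase j).card = 2 := by rw [hcard i hi j hj hij]; omega
    obtain ⟨i', j', hij', he⟩ := Finset.card_eq_two.1 h2
    refine ⟨i', hsub i j (by rw [he]; simp), j', hsub i j (by rw [he]; simp), hij', ?_⟩
    rw [he]; ext; simp
  by_cases hex : ∃ i ∈ S, ∃ j ∈ S, i ≠ j ∧ (Γ i ∪ Γ j).card + 2 ≤ 2 * q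
  · obtain ⟨i, hi, j, hj, hij, hd⟩ := hex
    obtain ⟨hδ, hk⟩ := key i hi j hj hij (2 * q - (Γ i ∪ Γ j).card) (by omega) (by omega)
    have e2 : 2 * q - (Γ i ∪ Γ j).card = 2 := by omega
    obtain ⟨i', hi', j', hj', hij', he⟩ := hpair i hi j hj hij
    obtain ⟨hδ', -⟩ := key i' hi' j' hj' hij' (2 * q - (Γ i' ∪ Γ j').card) (by omega)
      (by have := hpair_le i' j'; omega)
    rw [e2, he, h4] at hk
    rw [h4]
    omega
  · push Not at hex
    have := hex i₀ hi₀ j₀ hj₀ hij₀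
    have := hpair_le i₀ j₀
    obtain ⟨-, hk⟩ := key i₀ hi₀ j₀ hj₀ hij₀ 1 (by omega) (by omega)
    obtain ⟨i', hi', j', hj', hij', he⟩ := hpair i₀ hi₀ j₀ hj₀ hij₀
    have := hex i' hi' j' hj' hij'
    rw [he, h4] at hk
    rw [h4]
    omega

/-! ### Nullity, repair groups and the Singleton bound -/

section Vanishing

variable {F : Type*} [Field F] {n : ℕ}

/-- The subcode of the codewords of `C` that vanish on the coordinates in `S`. -/
def vanishing (C : Submodule F (Fin n → F)) (S : Finset (Fin n)) : Submodule F (Fin n → F) where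
  carrier := {x | x ∈ C ∧ ∀ i ∈ S, x i = 0}
  add_mem' hx hy := ⟨C.add_mem hx.1 hy.1, fun i hi => by simp [hx.2 i hi, hy.2 i hi]⟩
  zero_mem' := ⟨C.zero_mem, fun _ _ => rfl⟩
  smul_mem' c _ hx := ⟨C.smul_mem c hx.1, fun i hi => by simp [hx.2 i hi]⟩

theorem mem_vanishing {C : Submodule F (Fin n → F)} {S : Finset (Fin n)} {x : Fin n → F} :
    x ∈ vanishing C S ↔ x ∈ C ∧ ∀ i ∈ S, x i = 0 := Iff.rfl

theorem vanishing_empty (C : Submodule F (Fin n → F)) : vanishing C ∅ = C := by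
  ext; simp [mem_vanishing]

/-- The size of `S` plus the dimension of the subcode vanishing on `S`. -/
noncomputable def cardAddFinrank (C : Submodule F (Fin n → F)) (S : Finset (Fin n)) : ℕ :=
  S.card + Module.finrank F (vanishing C S)

theorem finrank_le_finrank_inf_ker_add_one {V : Type*} [AddCommGroup V] [Module F V]
    [FiniteDimensional F V] (U : Submodule F V) (f : V →ₗ[F] F) :
    Module.finrank F U ≤ Module.finrank F (U ⊓ LinearMap.ker f : Submodule F V) + 1 := by
  have h := LinearMap.finrank_range_add_finrank_ker (f.domRestrict U)
  have h1 : Module.finrank F (LinearMap.range (f.domRestrict U)) ≤ 1 := by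
    simpa using Submodule.finrank_le (LinearMap.range (f.domRestrict U))
  have h2 : Module.finrank F (LinearMap.ker (f.domRestrict U)) =
      Module.finrank F (U ⊓ LinearMap.ker f : Submodule F V) := by
    rw [LinearMap.ker_domRestrict, ← Submodule.map_comap_subtype]
    exact (LinearEquiv.finrank_eq (Submodule.equivSubtypeMap U _))
  omega

theorem finrank_vanishing_le_insert (C : Submodule F (Fin n → F)) (S : Finset (Fin n))
    (i : Fin n) : Module.finrank F (vanishing C S) ≤
      Module.finrank F (vanishing C (insert i S)) + 1 := by
  have h : vanishing C (insert i S) =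
      vanishing C S ⊓ LinearMap.ker (LinearMap.proj (R := F) (φ := fun _ : Fin n => F) i) := by
    ext x
    simp only [mem_vanishing, Finset.mem_insert, forall_eq_or_imp, Submodule.mem_inf,
      LinearMap.mem_ker, LinearMap.proj_apply]
    tauto
  rw [h]
  exact finrank_le_finrank_inf_ker_add_one _ _

/-- Each new coordinate adds one to the size and imposes one linear condition, which lowers the
dimension by at most one. -/
theorem cardAddFinrank_mono (C : Submodule F (Fin n → F)) {S T : Finset (Fin n)} (h : S ⊆ T) :
    cardAddFinrank C S ≤ cardAddFinrank C T := by
  rw [← Finset.union_eq_right.2 h, Finset.union_comm]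
  clear h
  induction T using Finset.induction_on with
  | empty => simp
  | insert i T hi ih =>
    refine ih.trans ?_
    rw [Finset.union_comm, Finset.union_comm _ S, Finset.union_insert]
    by_cases hm : i ∈ S ∪ T
    · rw [Finset.insert_eq_of_mem hm]
    · have := finrank_vanishing_le_insert C (S ∪ T) i
      unfold cardAddFinrank
      rw [Finset.card_insert_of_notMem hm]
      omega

theorem cardAddFinrank_univ (C : Submodule F (Fin n → F)) :
    cardAddFinrank C Finset.univ = n := by
  have : vanishing C Finset.univ = ⊥ := by
    rw [eq_bot_iff]
    intro x hx
    rw [Submodule.mem_bot]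
    exact funext fun i => hx.2 i (Finset.mem_univ i)
  simp [cardAddFinrank, this]

/-- Adjoining a repair group of a coordinate outside `U` raises `cardAddFinrank`. -/
theorem cardAddFinrank_lt_union (C : Submodule F (Fin n → F)) {i : Fin n} {R U : Finset (Fin n)}
    (hR : ∃ a : Fin n → F, ∀ x ∈ C, x i = ∑ j ∈ R, a j * x j) (hiR : i ∉ R) (hiU : i ∉ U) :
    cardAddFinrank C U < cardAddFinrank C (U ∪ insert i R) := by
  obtain ⟨a, ha⟩ := hR
  have h1 := cardAddFinrank_mono C (Finset.subset_union_left (s₁ := U) (s₂ := R))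
  have hm : i ∉ U ∪ R := by simp [hiU, hiR]
  have hv : vanishing C (insert i (U ∪ R)) = vanishing C (U ∪ R) := by
    ext x
    simp only [mem_vanishing]
    refine ⟨fun h => ⟨h.1, fun j hj => h.2 j (Finset.mem_insert_of_mem hj)⟩, fun h => ⟨h.1, ?_⟩⟩
    intro j hj
    rcases Finset.mem_insert.1 hj with rfl | hj
    · rw [ha x h.1]
      exact Finset.sum_eq_zero fun l hl => by rw [h.2 l (Finset.mem_union_right _ hl), mul_zero]
    · exact h.2 j hj
  rw [Finset.union_insert]
  unfold cardAddFinrank at *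
  rw [hv, Finset.card_insert_of_notMem hm]
  omega

theorem minDist_le_hammingNorm [DecidableEq F] {C : Submodule F (Fin n → F)} {x : Fin n → F}
    (hx : x ∈ C) (hx0 : x ≠ 0) : minDist C ≤ hammingNorm x :=
  Nat.sInf_le ⟨x, hx, 0, C.zero_mem, hx0, hammingDist_zero_right x⟩

/-- `C ≠ ⊥` excludes the infimum of the empty set, which is 0 by default. -/
theorem le_minDist [DecidableEq F] {C : Submodule F (Fin n → F)} {d : ℕ} (hC : C ≠ ⊥)
    (h : ∀ x ∈ C, x ≠ 0 → d ≤ hammingNorm x) : d ≤ minDist C := by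
  obtain ⟨x, hx, hx0⟩ := Submodule.exists_mem_ne_zero_of_ne_bot hC
  refine le_csInf ⟨_, x, hx, 0, C.zero_mem, hx0, rfl⟩ ?_
  rintro _ ⟨x, hx, y, hy, hxy, rfl⟩
  rw [hammingDist_eq_hammingNorm]
  exact h _ (C.add_mem (C.neg_mem hx) hy) (neg_add_eq_zero.not.2 hxy)

theorem hammingNorm_add_card_le [DecidableEq F] {x : Fin n → F} {S : Finset (Fin n)}
    (h : ∀ i ∈ S, x i = 0) : hammingNorm x + S.card ≤ n := by
  unfold hammingNorm
  rw [← Finset.card_union_of_disjoint]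
  · exact (Finset.card_le_univ _).trans (Fintype.card_fin n).le
  · rw [Finset.disjoint_left]
    intro i hi hiS
    exact (Finset.mem_filter.1 hi).2 (h i hiS)

/-- A generalized Singleton bound. -/
theorem minDist_add_cardAddFinrank_le [DecidableEq F] {C : Submodule F (Fin n → F)}
    {U : Finset (Fin n)} (hU : 0 < Module.finrank F (vanishing C U)) :
    minDist C + cardAddFinrank C U ≤ n + 1 := by
  -- Maximality makes the subcode vanishing on `V` one-dimensional, so `cardAddFinrank C V` is |V| +
  -- 1, and a nonzero word of that subcode has weight at most n - |V|.
  obtain ⟨V, hUV, hV⟩ := Finite.exists_le_maximal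
    (p := fun V : Finset (Fin n) => 0 < Module.finrank F (vanishing C V)) hU
  obtain ⟨i, hi⟩ : ∃ i, i ∉ V := by
    by_contra! hall
    have h1 := cardAddFinrank_univ C
    have h2 : V = Finset.univ := Finset.eq_univ_iff_forall.2 hall
    have h3 := hV.prop
    rw [h2] at h3
    unfold cardAddFinrank at h1
    rw [Finset.card_univ, Fintype.card_fin] at h1
    omega
  have h0 : ¬ 0 < Module.finrank F (vanishing C (insert i V)) := by
    intro h
    exact hi (hV.le_of_ge h (Finset.subset_insert i V) (Finset.mem_insert_self i V))
  have h1 := finrank_vanishing_le_insert C V i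
  have h2 := cardAddFinrank_mono C hUV
  obtain ⟨x, hx, hx0⟩ := Submodule.exists_mem_ne_zero_of_ne_bot
    (p := vanishing C V) (by
      intro h
      have h3 : 0 < Module.finrank F (vanishing C V) := hV.prop
      rw [h, finrank_bot] at h3
      exact lt_irrefl _ h3)
  have h3 := minDist_le_hammingNorm hx.1 hx0
  have h4 := hammingNorm_add_card_le hx.2
  unfold cardAddFinrank at *
  omega

/-- In a locally recoverable code there are `m` repair groups such that the subfamilies of size `t`
have unions of nullity at least `t`, as long as fewer than `m` of them cannot cover everything. -/
theorem IsLRC.exists_repair_groups {k r : ℕ} {C : Submodule F (Fin n → F)} (hC : IsLRC n k r C)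
    (m : ℕ) (hm : (m - 1) * (r + 1) < n) :
    ∃ Γ : Fin n → Finset (Fin n), (∀ i, (Γ i).card ≤ r + 1) ∧
      ∃ S : Finset (Fin n), S.card = m ∧
        ∀ T ⊆ S, k + T.card ≤ cardAddFinrank C (T.biUnion Γ) := by
  choose R hiR hRc hRa using hC.locality
  refine ⟨fun i => insert i (R i), fun i => ?_, ?_⟩
  · exact (Finset.card_insert_le _ _).trans (Nat.succ_le_succ (hRc i))
  induction m with
  | zero =>
    refine ⟨∅, rfl, fun T hT => ?_⟩
    rw [Finset.subset_empty.1 hT]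
    rw [Finset.biUnion_empty, cardAddFinrank, vanishing_empty, hC.finrank_eq, Finset.card_empty,
      zero_add, add_zero]
  | succ m ih =>
    obtain ⟨S, hS, hT⟩ := ih (lt_of_le_of_lt (Nat.mul_le_mul_right _ (by omega)) hm)
    have hlt : (S.biUnion fun i => insert i (R i)).card < n := by
      refine lt_of_le_of_lt (Finset.card_biUnion_le_card_mul _ _ (r + 1) fun i _ =>
        (Finset.card_insert_le _ _).trans (Nat.succ_le_succ (hRc i))) ?_
      rw [hS]; simpa using hm
    obtain ⟨i, hi⟩ : ∃ i, i ∉ S.biUnion fun i => insert i (R i) := by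
      by_contra! hall
      rw [Finset.eq_univ_iff_forall.2 hall, Finset.card_univ, Fintype.card_fin] at hlt
      exact lt_irrefl _ hlt
    have hiS : i ∉ S := fun h =>
      hi (Finset.mem_biUnion.2 ⟨i, h, Finset.mem_insert_self _ _⟩)
    refine ⟨insert i S, by rw [Finset.card_insert_of_notMem hiS, hS], fun T hTS => ?_⟩
    by_cases hiT : i ∈ T
    · have hsub : T.erase i ⊆ S := by
        rw [← Finset.erase_insert hiS]; exact Finset.erase_subset_erase _ hTS
      have h1 := hT _ hsub
      rw [← Finset.insert_erase hiT, Finset.biUnion_insert, Finset.union_comm,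
        Finset.card_insert_of_notMem (Finset.notMem_erase _ _)]
      have h2 := cardAddFinrank_lt_union C (hRa i) (hiR i)
        (fun h => hi (Finset.biUnion_subset_biUnion_of_subset_left _ hsub h))
      omega
    · exact hT T fun x hx => (Finset.mem_insert.1 (hTS hx)).resolve_left
        (by rintro rfl; exact hiT hx)

end Vanishing

/-! ### Generic subspaces over a large finite field -/

section Generic

variable {F V ι : Type*} [Field F] [AddCommGroup V] [Module F V]

/-- Counting: each `p i` meets `U` in at most a 1/|F| fraction of its vectors, so fewer than |F| of
them cannot cover `U`. -/
theorem exists_mem_forall_notMem [Finite F] [FiniteDimensional F V] (U : Submodule F V)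
    (s : Finset ι) (p : ι → Submodule F V) (hp : ∀ i ∈ s, ¬ U ≤ p i)
    (hs : s.card < Nat.card F) : ∃ x ∈ U, ∀ i ∈ s, x ∉ p i := by
  classical
  have : Finite V := Module.finite_of_finite F
  have := Fintype.ofFinite V
  by_contra! hcon
  have hF : 1 < Nat.card F := Finite.one_lt_card
  have hcard : ∀ P : Submodule F V, (Finset.univ.filter (· ∈ P)).card =
      Nat.card F ^ Module.finrank F P := by
    intro P
    rw [← Module.natCard_eq_pow_finrank (K := F), Nat.card_eq_fintype_card,
      Fintype.card_subtype]
  rcases s.eq_empty_or_nonempty with rfl | ⟨i₀, hi₀⟩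
  · obtain ⟨i, hi, -⟩ := hcon 0 U.zero_mem
    simp at hi
  have hlt : ∀ i ∈ s, Module.finrank F (U ⊓ p i : Submodule F V) < Module.finrank F U := fun i hi =>
    Submodule.finrank_lt_finrank_of_lt (lt_of_le_of_ne inf_le_left fun h =>
      hp i hi (inf_eq_left.1 h))
  have hsub : Finset.univ.filter (· ∈ U) ⊆
      s.biUnion fun i => Finset.univ.filter (· ∈ (U ⊓ p i : Submodule F V)) := by
    intro x hx
    rw [Finset.mem_filter] at hx
    obtain ⟨i, hi, hxi⟩ := hcon x hx.2
    exact Finset.mem_biUnion.2 ⟨i, hi, Finset.mem_filter.2 ⟨Finset.mem_univ _, hx.2, hxi⟩⟩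
  have h1 := (Finset.card_le_card hsub).trans (Finset.card_biUnion_le_card_mul s _
    (Nat.card F ^ (Module.finrank F U - 1)) fun i hi => by
      rw [hcard]
      exact Nat.pow_le_pow_right hF.le (by have := hlt i hi; omega))
  rw [hcard] at h1
  have h2 : Module.finrank F U = Module.finrank F U - 1 + 1 := by have := hlt i₀ hi₀; omega
  rw [h2, Nat.add_sub_cancel, pow_succ, mul_comm] at h1
  have h3 := Nat.le_of_mul_le_mul_right h1 (pow_pos (by omega) _)
  omega

/-- Over a large finite field, finitely many subspaces of codimension at least `k` in `U` are
avoided by a `k`-dimensional subspace of `U`. -/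
theorem exists_finrank_eq_forall_disjoint [Finite F] [FiniteDimensional F V] (U : Submodule F V)
    (s : Finset ι) (hne : s.Nonempty) (K : ι → Submodule F V) (hs : s.card < Nat.card F) (k : ℕ)
    (hK : ∀ i ∈ s, Module.finrank F (K i) + k ≤ Module.finrank F U) :
    ∃ C ≤ U, Module.finrank F C = k ∧ ∀ i ∈ s, Disjoint C (K i) := by
  induction k with
  | zero => exact ⟨⊥, bot_le, finrank_bot F V, fun _ _ => disjoint_bot_left⟩
  | succ k ih =>
    obtain ⟨C, hCU, hCk, hC⟩ := ih fun i hi => by have := hK i hi; omega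
    obtain ⟨x, hxU, hx⟩ := exists_mem_forall_notMem U s (fun i => C ⊔ K i) (fun i hi hle => by
      have h1 := Submodule.finrank_mono hle
      have h2 := Submodule.finrank_add_le_finrank_add_finrank C (K i)
      have := hK i hi
      omega) hs
    obtain ⟨i₀, hi₀⟩ := hne
    have hxC : x ∉ C := fun h => hx i₀ hi₀ (Submodule.mem_sup_left h)
    have hx0 : x ≠ 0 := by rintro rfl; exact hxC C.zero_mem
    refine ⟨C ⊔ Submodule.span F {x},
      sup_le hCU ((Submodule.span_singleton_le_iff_mem _ _).2 hxU), ?_, fun i hi => ?_⟩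
    · have h := Submodule.finrank_sup_add_finrank_inf_eq C (Submodule.span F {x})
      rw [((Submodule.disjoint_span_singleton' hx0).2 hxC).eq_bot, finrank_bot,
        finrank_span_singleton hx0, hCk] at h
      omega
    · rw [Submodule.disjoint_def]
      intro v hv hvK
      obtain ⟨c, hc, y, hy, rfl⟩ := Submodule.mem_sup.1 hv
      obtain ⟨t, rfl⟩ := Submodule.mem_span_singleton.1 hy
      have ht : t = 0 := by
        by_contra ht
        have h1 : t • x ∈ C ⊔ K i := by
          have := Submodule.sub_mem (C ⊔ K i) (Submodule.mem_sup_right hvK)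
            (Submodule.mem_sup_left hc)
          simpa using this
        exact hx i hi ((Submodule.smul_mem_iff _ ht).1 h1)
      subst ht
      rw [zero_smul, add_zero] at hvK ⊢
      exact Submodule.disjoint_def.1 (hC i hi) c hc hvK

end Generic

/-! ### Duality between vanishing codewords and supported checks -/

section Matrix

variable {F ι : Type*} [Field F] [Fintype ι] {n : ℕ}

/-- The combinations of the rows of `H` that are supported inside `S`. -/
def rowsSupportedIn (H : Matrix ι (Fin n) F) (S : Finset (Fin n)) : Submodule F (ι → F) where
  carrier := {w | ∀ e ∉ S, Matrix.vecMul w H e = 0}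
  add_mem' hx hy e he := by simp [Matrix.add_vecMul, hx e he, hy e he]
  zero_mem' e _ := by simp
  smul_mem' c x hx e he := by simp [Matrix.smul_vecMul, hx e he]

/-- Let `H'` consist of the columns of `H` outside `S`. The words vanishing on `S` embed in its
kernel, the row combinations supported in `S` form its left kernel, and row rank equals column rank.
-/
theorem finrank_vanishing_ker_le (H : Matrix ι (Fin n) F) (S : Finset (Fin n)) :
    Module.finrank F (vanishing (LinearMap.ker H.mulVecLin) S) + Fintype.card ι + S.card ≤
      n + Module.finrank F (rowsSupportedIn H S) := by
  classical
  let H' : Matrix ι {e // e ∉ S} F := H.submatrix id Subtype.val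
  have h1 := LinearMap.finrank_range_add_finrank_ker H'.mulVecLin
  have h2 := LinearMap.finrank_range_add_finrank_ker H'.transpose.mulVecLin
  have h3 : Module.finrank F (LinearMap.range H'.transpose.mulVecLin) =
      Module.finrank F (LinearMap.range H'.mulVecLin) := Matrix.rank_transpose H'
  rw [Module.finrank_fintype_fun_eq_card] at h1 h2
  have h4 : Fintype.card {e // e ∉ S} + S.card = n := by
    have := Finset.card_le_univ S
    rw [Fintype.card_fin] at this
    rw [Fintype.card_subtype_compl, Fintype.card_fin, Fintype.card_coe]
    omega
  have h5 : LinearMap.ker H'.transpose.mulVecLin = rowsSupportedIn H S := by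
    ext w
    rw [LinearMap.mem_ker, Matrix.mulVecLin_apply, Matrix.mulVec_transpose, funext_iff]
    exact ⟨fun h e he => h ⟨e, he⟩, fun h e => h e.1 e.2⟩
  have h6 : Module.finrank F (vanishing (LinearMap.ker H.mulVecLin) S) ≤
      Module.finrank F (LinearMap.ker H'.mulVecLin) := by
    have hmem : ∀ x : vanishing (LinearMap.ker H.mulVecLin) S,
        LinearMap.funLeft F F (Subtype.val : {e // e ∉ S} → Fin n) x.1 ∈
          LinearMap.ker H'.mulVecLin := by
      rintro ⟨x, hx, hxS⟩
      rw [LinearMap.mem_ker, Matrix.mulVecLin_apply] at hx ⊢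
      ext i
      have := congrFun hx i
      rw [Matrix.mulVec, dotProduct] at this ⊢
      rw [← this, ← Finset.sum_subset (Finset.subset_univ (Finset.univ.filter (· ∉ S)))]
      · rw [← Finset.sum_subtype_of_mem (p := (· ∉ S)) (fun e => H i e * x e) (by simp),
          Finset.subtype_eq_univ.2 (by simp)]
        rfl
      · intro e _ he
        rw [hxS e (by simpa using he), mul_zero]
    refine LinearMap.finrank_le_finrank_of_injective
      (f := LinearMap.codRestrict _ ((LinearMap.funLeft F F
        (Subtype.val : {e // e ∉ S} → Fin n)).domRestrict _) hmem) ?_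
    rintro ⟨x, hx⟩ ⟨y, hy⟩ hxy
    ext e
    by_cases he : e ∈ S
    · exact (hx.2 e he).trans (hy.2 e he).symm
    · exact congrFun (congrArg Subtype.val hxy) ⟨e, he⟩
  rw [h5] at h2
  omega

theorem finrank_le_card_of_forall_eq_zero (W : Submodule F (ι → F)) (Q : Finset ι)
    (h : ∀ w ∈ W, (∀ i ∈ Q, w i = 0) → w = 0) : Module.finrank F W ≤ Q.card := by
  have := LinearMap.finrank_le_finrank_of_injective
    (f := (LinearMap.funLeft F F (Subtype.val : Q → ι)).domRestrict W) (by
      rw [← LinearMap.ker_eq_bot, LinearMap.ker_eq_bot']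
      rintro ⟨w, hw⟩ h0
      exact Subtype.ext (h w hw fun i hi => congrFun h0 ⟨i, hi⟩))
  rwa [Module.finrank_fintype_fun_eq_card, Fintype.card_coe] at this

end Matrix

/-! ### Bipartite arrangements of repair groups -/

/-- Repair groups of size `r + 1` given by a simple bipartite graph with at most `r` edges: a
coordinate `e` lies in the groups `a e` and `b e`, and is an edge of the graph if these differ. -/
structure IsBipartiteArrangement {n m : ℕ} (r h : ℕ) (a b : Fin n → Fin m) : Prop where
  card_group : ∀ i, (Finset.univ.filter fun e => a e = i ∨ b e = i).card = r + 1
  bipartite : ∀ e, a e ≠ b e → (a e).val < h ∧ h ≤ (b e).val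
  simple : ∀ e e', a e ≠ b e → a e = a e' → b e = b e' → e = e'
  card_edges : (Finset.univ.filter fun e => a e ≠ b e).card ≤ r

/-- Any s edges of the balanced complete bipartite graph on m vertices will do. -/
theorem exists_isBipartiteArrangement {n m r s : ℕ} (hn : n + s = m * (r + 1)) (hsr : s ≤ r)
    (hsm : s ≤ (m / 2) * (m - m / 2)) :
    ∃ a b : Fin n → Fin m, IsBipartiteArrangement r (m / 2) a b := by
  classical
  let A : Finset (Fin m) := Finset.univ.filter fun i => i.val < m / 2
  let B : Finset (Fin m) := Finset.univ.filter fun i => ¬ i.val < m / 2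
  have hA : A.card = m / 2 := by
    have : A = Finset.univ.map (Fin.castLEEmb (Nat.div_le_self m 2)) := by
      ext i
      simp only [A, Finset.mem_filter, Finset.mem_univ, true_and, Finset.mem_map,
        Fin.castLEEmb_apply]
      exact ⟨fun h => ⟨⟨i, h⟩, rfl⟩, by rintro ⟨j, rfl⟩; exact j.2⟩
    rw [this, Finset.card_map, Finset.card_univ, Fintype.card_fin]
  have hAB : A.card + B.card = m := by
    rw [Finset.card_filter_add_card_filter_not, Finset.card_univ, Fintype.card_fin]
  obtain ⟨G, hG, hGs⟩ := Finset.exists_subset_card_eq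
    (show s ≤ (A ×ˢ B).card by
      rwa [Finset.card_product, hA, show B.card = m - m / 2 by omega])
  have hG' : ∀ g ∈ G, g.1.val < m / 2 ∧ m / 2 ≤ g.2.val := by
    intro g hg
    have := hG hg
    simp only [A, B, Finset.mem_product, Finset.mem_filter, Finset.mem_univ, true_and] at this
    omega
  let deg : Fin m → ℕ := fun i => (G.filter fun g => g.1 = i ∨ g.2 = i).card
  have hdeg : ∀ i, deg i ≤ r := fun i => (Finset.card_filter_le _ _).trans (by omega)
  have hsum : ∑ i, deg i = 2 * s := by
    have : ∑ i, deg i = ∑ g ∈ G, (Finset.univ.filter fun i => g.1 = i ∨ g.2 = i).card := by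
      simp only [deg, Finset.card_filter]
      exact Finset.sum_comm
    rw [this, Finset.sum_const_nat (m := 2), hGs, mul_comm]
    intro g hg
    rw [Finset.card_eq_two]
    refine ⟨g.1, g.2, fun h => ?_, ?_⟩
    · have := hG' g hg
      rw [h] at this
      omega
    · ext i; simp [eq_comm]
  -- Coordinates are the edges together with r + 1 - deg i private ones at each vertex i: s + m(r +
  -- 1) - 2s = n in all.
  let E := G ⊕ (Σ i : Fin m, Fin (r + 1 - deg i))
  have hE : Fintype.card (Fin n) = Fintype.card E := by
    have h1 : ∑ i, (r + 1 - deg i) + ∑ i, deg i = m * (r + 1) := by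
      rw [← Finset.sum_add_distrib, Finset.sum_const_nat (m := r + 1), Finset.card_univ,
        Fintype.card_fin]
      intro i _
      have := hdeg i
      omega
    simp only [E, Fintype.card_sum, Fintype.card_sigma, Fintype.card_fin, Fintype.card_coe]
    omega
  let f : Fin n ≃ E := Fintype.equivOfCardEq hE
  let a : E → Fin m := Sum.elim (fun g => g.1.1) (fun p => p.1)
  let b : E → Fin m := Sum.elim (fun g => g.1.2) (fun p => p.1)
  have hedge : ∀ e, a e ≠ b e → ∃ g, e = Sum.inl g := by
    rintro (g | p) h
    · exact ⟨g, rfl⟩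
    · exact absurd rfl h
  refine ⟨a ∘ f, b ∘ f, fun i => ?_, fun e he => ?_, fun e e' he h1 h2 => ?_, ?_⟩
  · rw [Finset.card_filter]
    refine (Equiv.sum_comp f (fun e => if a e = i ∨ b e = i then 1 else 0)).trans ?_
    rw [Fintype.sum_sum_type, Fintype.sum_sigma]
    have h1 : ∑ g : G, (if a (Sum.inl g) = i ∨ b (Sum.inl g) = i then 1 else 0) = deg i := by
      simp only [deg, Finset.card_filter]
      exact Finset.sum_coe_sort G fun g => if g.1 = i ∨ g.2 = i then 1 else 0
    rw [h1]
    have h2 : ∀ x : Fin m, ∑ y : Fin (r + 1 - deg x),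
        (if a (Sum.inr ⟨x, y⟩) = i ∨ b (Sum.inr ⟨x, y⟩) = i then 1 else 0) =
          if x = i then r + 1 - deg x else 0 := by
      intro x
      simp [a, b]
    rw [Finset.sum_congr rfl fun x _ => h2 x, Finset.sum_ite_eq' Finset.univ i]
    have := hdeg i
    simp only [Finset.mem_univ, if_true]
    omega
  · obtain ⟨g, hg⟩ := hedge _ he
    simp only [Function.comp, hg]
    exact hG' g.1 g.2
  · apply f.injective
    obtain ⟨g, hg⟩ := hedge _ he
    have he' : a (f e') ≠ b (f e') := by
      simp only [Function.comp] at h1 h2 he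
      rwa [← h1, ← h2]
    obtain ⟨g', hg'⟩ := hedge _ he'
    simp only [Function.comp, hg, hg'] at h1 h2
    rw [hg, hg']
    exact congrArg Sum.inl (Subtype.ext (Prod.ext h1 h2))
  · calc _ ≤ ((Finset.univ : Finset G).map
          (Function.Embedding.inl.trans f.symm.toEmbedding)).card := by
          refine Finset.card_le_card fun e he => ?_
          rw [Finset.mem_filter] at he
          obtain ⟨g, hg⟩ := hedge _ he.2
          rw [Finset.mem_map]
          exact ⟨g, Finset.mem_univ _, by simp [← hg]⟩
      _ ≤ r := by
          rw [Finset.card_map, Finset.card_univ, Fintype.card_coe, hGs]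
          exact hsr

/-! ### The code of an arrangement and its generic subcode -/

section Code

variable {F : Type*} [Field F] {n m : ℕ}

/-- The parity check matrix whose rows are the indicators of the repair groups. -/
def groupMatrix (F : Type*) [Field F] (a b : Fin n → Fin m) : Matrix (Fin m) (Fin n) F :=
  fun i e => if a e = i ∨ b e = i then 1 else 0

theorem vecMul_groupMatrix (a b : Fin n → Fin m) (w : Fin m → F) (e : Fin n) :
    Matrix.vecMul w (groupMatrix F a b) e =
      if a e = b e then w (a e) else w (a e) + w (b e) := by
  simp only [Matrix.vecMul, dotProduct, groupMatrix, mul_ite, mul_one, mul_zero]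
  rw [← Finset.sum_filter]
  split_ifs with h
  · have : (Finset.univ.filter fun i => a e = i ∨ b e = i) = {a e} := by
      ext i; simp [← h, eq_comm]
    rw [this, Finset.sum_singleton]
  · have : (Finset.univ.filter fun i => a e = i ∨ b e = i) = {a e, b e} := by
      ext i; simp [eq_comm]
    rw [this, Finset.sum_pair h]

/-- If the dimension were at least 3, let `T` be the groups that occur in `W`. Incidences between
`T` and the coordinates are double counted. An edge inside `T` but outside `S` forces `w (a e) + w
(b e) = 0`, so it spends a degree of freedom of `W`; hence few such edges exist, and `S` is too
small to account for the rest. -/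
theorem IsBipartiteArrangement.finrank_rowsSupportedIn_le {r h : ℕ} {a b : Fin n → Fin m}
    (hab : IsBipartiteArrangement r h a b) (S : Finset (Fin n)) (hS : S.card ≤ 3 * r) :
    Module.finrank F (rowsSupportedIn (groupMatrix F a b) S) ≤ 2 := by
  classical
  set W := rowsSupportedIn (groupMatrix F a b) S with hW
  by_contra! hdim
  let T : Finset (Fin m) := Finset.univ.filter fun i => ∃ w ∈ W, w i ≠ 0
  have hT : ∀ i ∉ T, ∀ w ∈ W, w i = 0 := by
    intro i hi w hw
    by_contra h0
    exact hi (Finset.mem_filter.2 ⟨Finset.mem_univ _, w, hw, h0⟩)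
  have hT0 : ∀ i ∈ T, ¬ ∀ w ∈ W, w i = 0 := by
    intro i hi hall
    obtain ⟨w, hw, h0⟩ := (Finset.mem_filter.1 hi).2
    exact h0 (hall w hw)
  -- a set of positions that determines the members of `W` has at least three elements
  have hdet : ∀ Q : Finset (Fin m), (∀ w ∈ W, (∀ i ∈ Q, w i = 0) → ∀ i ∈ T, w i = 0) →
      3 ≤ Q.card := by
    intro Q hQ
    refine hdim.trans_le (finrank_le_card_of_forall_eq_zero W Q fun w hw h0 => ?_)
    ext i
    by_cases hi : i ∈ T
    · exact hQ w hw h0 i hi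
    · exact hT i hi w hw
  have hWe : ∀ e ∉ S, ∀ w ∈ W, (if a e = b e then w (a e) else w (a e) + w (b e)) = 0 :=
    fun e he w hw => by rw [← vecMul_groupMatrix]; exact hw e he
  let E₂ : Finset (Fin n) := Finset.univ.filter fun e => a e ≠ b e ∧ a e ∈ T ∧ b e ∈ T
  let E₃ : Finset (Fin n) := E₂.filter (· ∉ S)
  have hE₃ : ∀ e ∈ E₃, a e ≠ b e ∧ a e ∈ T ∧ b e ∈ T ∧
      ∀ w ∈ W, w (a e) = 0 ↔ w (b e) = 0 := by
    intro e he
    simp only [E₃, E₂, Finset.mem_filter, Finset.mem_univ, true_and] at he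
    refine ⟨he.1.1, he.1.2.1, he.1.2.2, fun w hw => ?_⟩
    have := hWe e he.2 w hw
    rw [if_neg he.1.1] at this
    constructor <;> intro h0 <;> simpa [h0] using this
  -- Outside `S`, a coordinate with exactly one of its groups in `T` would force all of `W` to
  -- vanish at that group; so it meets `T` not at all or is an edge of `E₃`, counted twice.
  have hpt : ∀ e, (T.filter fun i => a e = i ∨ b e = i).card ≤
      (if e ∈ S then 1 else 0) + (if e ∈ E₂ then 1 else 0) + (if e ∈ E₃ then 1 else 0) := by
    intro e
    have hsub : (T.filter fun i => a e = i ∨ b e = i) ⊆ {a e, b e} := by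
      intro i hi
      have := (Finset.mem_filter.1 hi).2
      simp only [Finset.mem_insert, Finset.mem_singleton]
      tauto
    have h2 := (Finset.card_le_card hsub).trans Finset.card_le_two
    by_cases heE : e ∈ E₂
    · by_cases heS : e ∈ S <;> simp [E₃, heE, heS] <;> omega
    · have heE₃ : e ∉ E₃ := fun h => heE (Finset.mem_filter.1 h).1
      rw [if_neg heE, if_neg heE₃]
      simp only [E₂, Finset.mem_filter, Finset.mem_univ, true_and, not_and] at heE
      by_cases heS : e ∈ S
      · rw [if_pos heS, Finset.card_le_one]
        intro i hi j hj
        rw [Finset.mem_filter] at hi hj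
        rcases hi with ⟨hi, rfl | rfl⟩ <;> rcases hj with ⟨hj, hj' | hj'⟩
        · exact hj'
        · by_contra hne
          exact heE (by rw [hj']; exact hne) hi (by rw [hj']; exact hj)
        · by_contra hne
          exact heE (by rw [hj']; exact fun h => hne h.symm) (by rw [hj']; exact hj) hi
        · exact hj'
      · rw [if_neg heS, Nat.le_zero, Finset.card_eq_zero, Finset.filter_eq_empty_iff]
        have hw := hWe e heS
        intro i hi hor
        by_cases hne : a e = b e
        · simp only [if_pos hne] at hw
          rcases hor with rfl | rfl
          · exact hT0 _ hi hw
          · exact hT0 _ hi (hne ▸ hw)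
        · simp only [if_neg hne] at hw
          rcases hor with rfl | rfl
          · exact hT0 _ hi fun w hwW => by
              have := hw w hwW
              rwa [hT _ (heE hne hi) w hwW, add_zero] at this
          · exact hT0 _ hi fun w hwW => by
              have := hw w hwW
              rwa [hT _ (fun h => heE hne h hi) w hwW, zero_add] at this
  have hcount : T.card * (r + 1) ≤ S.card + E₂.card + E₃.card := by
    calc T.card * (r + 1)
        = ∑ i ∈ T, (Finset.univ.filter fun e => a e = i ∨ b e = i).card :=
          (Finset.sum_const_nat fun i _ => hab.card_group i).symm
      _ = ∑ e, (T.filter fun i => a e = i ∨ b e = i).card := by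
          simp only [Finset.card_filter]
          exact Finset.sum_comm
      _ ≤ ∑ e, ((if e ∈ S then 1 else 0) + (if e ∈ E₂ then 1 else 0) +
            (if e ∈ E₃ then 1 else 0)) := Finset.sum_le_sum fun e _ => hpt e
      _ = _ := by simp [Finset.sum_add_distrib]
  have hE₂r : E₂.card ≤ r := (Finset.card_le_card fun e he => by
    simp only [E₂, Finset.mem_filter, Finset.mem_univ, true_and] at he ⊢
    exact he.1).trans hab.card_edges
  have hE₃₂ : E₃.card ≤ E₂.card := Finset.card_filter_le _ _
  have hT3 := hdet T fun w _ h0 => h0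
  -- Five or more groups need at least 5r + 5 incidences, but only 3r + r + r are available.
  rcases le_or_gt 5 T.card with h5 | h5
  · have := Nat.mul_le_mul_right (r + 1) h5
    omega
  rcases (by omega : T.card = 3 ∨ T.card = 4) with h3 | h4
  -- Three groups: an edge in `E₃` would leave two positions determining `W`, and a bipartite graph
  -- on three vertices has at most two edges, so 3r + 3 ≤ 3r + 2.
  · have hE₃0 : E₃.card = 0 := by
      rw [Finset.card_eq_zero, Finset.eq_empty_iff_forall_notMem]
      intro e he
      obtain ⟨hne, haT, hbT, hw⟩ := hE₃ e he
      have := hdet (T.erase (a e)) fun w hwW h0 i hi => by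
        by_cases hia : i = a e
        · rw [hia, hw w hwW]
          exact h0 _ (Finset.mem_erase.2 ⟨hne.symm, hbT⟩)
        · exact h0 _ (Finset.mem_erase.2 ⟨hia, hi⟩)
      rw [Finset.card_erase_of_mem haT] at this
      omega
    have hE₂2 : E₂.card ≤ 2 := by
      have h1 : E₂.card ≤ (T.filter (fun i => i.val < h) ×ˢ
          T.filter (fun i => ¬ i.val < h)).card := by
        refine Finset.card_le_card_of_injOn (fun e => (a e, b e)) (fun e he => ?_) ?_
        · simp only [E₂, Finset.coe_filter, Finset.mem_univ, true_and, Set.mem_ofPred_eq] at he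
          have := hab.bipartite e he.1
          simp only [Finset.coe_product, Set.mem_prod, Finset.mem_coe, Finset.mem_filter]
          exact ⟨⟨he.2.1, this.1⟩, he.2.2, by omega⟩
        · intro e he e' _ hee
          simp only [E₂, Finset.coe_filter, Finset.mem_univ, true_and, Set.mem_ofPred_eq] at he
          exact hab.simple e e' he.1 (Prod.ext_iff.1 hee).1 (Prod.ext_iff.1 hee).2
      have h2 := Finset.card_filter_add_card_filter_not (s := T) (fun i => i.val < h)
      rw [Finset.card_product] at h1
      generalize (T.filter (fun i => i.val < h)).card = p at h1 h2
      generalize (T.filter (fun i => ¬ i.val < h)).card = q at h1 h2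
      have : p ≤ 3 := by omega
      obtain rfl : q = 3 - p := by omega
      interval_cases p <;> omega
    rw [h3] at hcount
    omega
  -- Four groups: two edges in `E₃` would again leave two determining positions; with at most one,
  -- 4r + 4 ≤ 3r + r + 1.
  · have hE₃1 : E₃.card ≤ 1 := by
      rw [Finset.card_le_one]
      intro e he e' he'
      by_contra hee
      obtain ⟨hne, haT, hbT, hw⟩ := hE₃ e he
      obtain ⟨hne', haT', hbT', hw'⟩ := hE₃ e' he'
      have hbip := hab.bipartite e hne
      have hbip' := hab.bipartite e' hne'
      -- each edge has an end outside the other, determined by its other end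
      have hxy : ∀ x ∈ T, ∀ y ∈ T, ∀ x' ∈ T, ∀ y' ∈ T, x ≠ y → x' ≠ x → x' ≠ y → y' ≠ x →
          y' ≠ y → (∀ w ∈ W, w x = 0 ↔ w x' = 0) → (∀ w ∈ W, w y = 0 ↔ w y' = 0) → False := by
        intro x hx y hy x' hx' y' hy' h1 h2 h3 h4 h5 h6 h7
        have := hdet ((T.erase x).erase y) fun w hwW h0 i hi => by
          by_cases hix : i = x
          · rw [hix, h6 w hwW]
            exact h0 _ (by simp [*])
          by_cases hiy : i = y
          · rw [hiy, h7 w hwW]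
            exact h0 _ (by simp [*])
          exact h0 _ (by simp [*])
        rw [Finset.card_erase_of_mem (Finset.mem_erase.2 ⟨h1.symm, hy⟩),
          Finset.card_erase_of_mem hx] at this
        omega
      have hne_of : ∀ i j : Fin m, i.val < h → h ≤ j.val → i ≠ j := by
        rintro i j hi hj rfl
        omega
      by_cases haa : a e = a e'
      · have hbb : b e ≠ b e' := fun hbb => hee (hab.simple e e' hne haa hbb)
        exact hxy (b e') hbT' (b e) hbT (a e') haT' (a e) haT hbb.symm hne'
          (hne_of _ _ hbip'.1 hbip.2) (hne_of _ _ hbip.1 hbip'.2) hne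
          (fun w hwW => (hw' w hwW).symm) (fun w hwW => (hw w hwW).symm)
      · exact hxy (a e') haT' (a e) haT (b e') hbT' (b e) hbT (fun h => haa h.symm) hne'.symm
          (hne_of _ _ hbip.1 hbip'.2).symm (hne_of _ _ hbip'.1 hbip.2).symm hne.symm hw' hw
    rw [h4] at hcount
    omega

theorem exists_isLRC_of_isBipartiteArrangement {k r h : ℕ} {a b : Fin n → Fin m}
    (hab : IsBipartiteArrangement r h a b) (hk : k + 2 = 3 * r)
    (hkn : k + 2 ≤ n) :
    ∃ d ∈ minDistSet n k r, n ≤ d + k + 1 := by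
  classical
  obtain ⟨p, hp, hprime⟩ := Nat.exists_infinite_primes
    ((Finset.powersetCard (3 * r) (Finset.univ : Finset (Fin n))).card + 1)
  have : Fact p.Prime := ⟨hprime⟩
  set C₀ := LinearMap.ker (groupMatrix (ZMod p) a b).mulVecLin with hC₀
  have hdim : n ≤ Module.finrank (ZMod p) C₀ + m := by
    have h1 := LinearMap.finrank_range_add_finrank_ker (groupMatrix (ZMod p) a b).mulVecLin
    have h2 := Submodule.finrank_le (LinearMap.range (groupMatrix (ZMod p) a b).mulVecLin)
    simp only [Module.finrank_fintype_fun_eq_card, Fintype.card_fin] at h1 h2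
    rw [← hC₀] at h1
    omega
  -- For each 3r-set the vanishing subcode has dimension at most n - m - 3r + 2, while `C₀` has
  -- dimension at least n - m; the gap is at least 3r - 2 = k.
  obtain ⟨C, hCC₀, hCk, hC⟩ := exists_finrank_eq_forall_disjoint C₀
    (Finset.powersetCard (3 * r) (Finset.univ : Finset (Fin n)))
    (Finset.powersetCard_nonempty.2 (by rw [Finset.card_univ, Fintype.card_fin]; omega))
    (vanishing C₀) (by rw [Nat.card_zmod]; omega) k (by
      intro S hS
      have hS := (Finset.mem_powersetCard.1 hS).2
      have h1 := finrank_vanishing_ker_le (groupMatrix (ZMod p) a b) S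
      have h2 := hab.finrank_rowsSupportedIn_le (F := ZMod p) S hS.le
      rw [Fintype.card_fin, ← hC₀] at h1
      omega)
  refine ⟨minDist C, ⟨ZMod p, inferInstance, inferInstance, C, ⟨hCk, fun e => ?_⟩, ?_⟩, ?_⟩
  · have he : e ∈ Finset.univ.filter fun e' => a e' = a e ∨ b e' = a e := by simp
    refine ⟨(Finset.univ.filter fun e' => a e' = a e ∨ b e' = a e).erase e,
      Finset.notMem_erase _ _, ?_, fun _ => -1, fun x hx => ?_⟩
    · rw [Finset.card_erase_of_mem he, hab.card_group]; omega
    · have h0 : ∑ e' ∈ Finset.univ.filter (fun e' => a e' = a e ∨ b e' = a e), x e' = 0 := by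
        have := congrFun (LinearMap.mem_ker.1 (hCC₀ hx)) (a e)
        simpa [Matrix.mulVecLin_apply, Matrix.mulVec, dotProduct, groupMatrix,
          Finset.sum_filter] using this
      rw [← Finset.add_sum_erase _ _ he] at h0
      simp only [neg_mul, one_mul, Finset.sum_neg_distrib]
      exact eq_neg_of_add_eq_zero_left h0
  · congr
  · suffices n - k - 1 ≤ minDist C by omega
    refine le_minDist (by rintro rfl; simp at hCk; omega) fun x hx hx0 => ?_
    by_contra! hlt
    have hz : 3 * r ≤ (Finset.univ.filter fun e => x e = 0).card := by
      have := Finset.card_filter_add_card_filter_not (s := (Finset.univ : Finset (Fin n)))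
        (fun e => x e = 0)
      rw [Finset.card_univ, Fintype.card_fin] at this
      unfold hammingNorm at hlt
      simp only [ne_eq] at hlt
      omega
    obtain ⟨S, hS, hSc⟩ := Finset.exists_subset_card_eq hz
    exact hx0 (Submodule.disjoint_def.1
      (hC S (Finset.mem_powersetCard.2 ⟨Finset.subset_univ _, hSc⟩)) x hx
      ⟨hCC₀ hx, fun i hi => (Finset.mem_filter.1 (hS hi)).2⟩)

end Code

/-! ### The upper bound on the distance -/

/-- Both halves of the upper bound: `d ≤ n - k - 1`, and equality forces `4 n₂ ≤ n₁²`. -/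
theorem add_le_of_mem_minDistSet {n k r m : ℕ} (hk : k + 2 = 3 * r) (hr : 3 ≤ r) (hm : 3 ≤ m)
    (hmn : (m - 1) * (r + 1) < n) {d : ℕ} (hd : d ∈ minDistSet n k r) :
    d + k + 1 ≤ n ∧ (d + k + 1 = n → 4 * (m * (r + 1)) ≤ 4 * n + m ^ 2) := by
  classical
  obtain ⟨F, _, _, C, hC, rfl⟩ := hd
  obtain ⟨Γ, hΓ, S, hS, hT⟩ := hC.exists_repair_groups m hmn
  constructor
  · obtain ⟨T, hTS, hTc⟩ := Finset.exists_subset_card_eq (show 2 ≤ S.card by omega)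
    have h1 := hT T hTS
    have h2 := Finset.card_biUnion_le_card_mul T Γ (r + 1) fun i _ => hΓ i
    rw [hTc] at h1 h2
    -- The subcode vanishing on two groups has dimension at least k + 2 - 2(r + 1) = r - 2 > 0.
    have h3 := minDist_add_cardAddFinrank_le (C := C) (U := T.biUnion Γ)
      (by unfold cardAddFinrank at h1; omega)
    omega
  · intro hd
    have h1 := mul_card_le_card_biUnion_add_sq Γ (r + 1) hΓ S (by omega) fun T hTS hTc => by
      have h1 := hT T hTS
      rw [hTc] at h1
      -- A nonzero subcode vanishing on three groups would give d + k + 3 ≤ n + 1, against d + k + 1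
      -- = n. So it is zero and the nullity bound becomes a bound on the size of the union.
      rcases Nat.eq_zero_or_pos (Module.finrank F (vanishing C (T.biUnion Γ))) with h0 | h0
      · unfold cardAddFinrank at h1
        omega
      · have h3 := minDist_add_cardAddFinrank_le h0
        omega
    have h2 : (S.biUnion Γ).card ≤ n := by
      simpa using Finset.card_le_univ (S.biUnion Γ)
    rw [hS] at h1
    omega

end LRC

/-! ### Reduction to natural numbers and conclusion -/

theorem mainTheorem5 (n k r : ℕ) (hr : 1 ≤ r) (hrk : r ≤ k) (hkn : k < n)
    (hLRC : ∃ (F : Type) (_ : Field F) (_ : Finite F) (C : Submodule F (Fin n → F)),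
      LRC.IsLRC n k r C)
    (hk₁ : LRC.k₁ k r = 3) (hk₂ : LRC.k₂ k r = 2) :
    (LRC.largestMinDist n k r : ℤ) = LRC.dStar n k r ↔
      LRC.n₂ n r ≤ ⌊((LRC.n₁ n r : ℚ) ^ 2) / 4⌋ := by
  classical
  have hk : k + 2 = 3 * r := by
    rw [LRC.k₂, hk₁] at hk₂
    omega
  -- ⌈k/r⌉ = 3 gives 2r < k = 3r - 2.
  have hr3 : 3 ≤ r := by
    have h1 := (Int.ceil_eq_iff.1 hk₁).1
    rw [lt_div_iff₀ (by exact_mod_cast hr)] at h1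
    push_cast at h1
    have h2 : ((2 * r : ℕ) : ℚ) < (k : ℚ) := by push_cast; linarith
    have h3 : 2 * r < k := by exact_mod_cast h2
    omega
  have hdStar : LRC.dStar n k r = n - k - 1 := by
    rw [LRC.dStar, ← LRC.k₁, hk₁]
    ring
  obtain ⟨m, hm⟩ : ∃ m : ℕ, LRC.n₁ n r = m :=
    Int.eq_ofNat_of_zero_le (Int.ceil_nonneg (by positivity))
  obtain ⟨hlow, hup⟩ : (m - 1) * (r + 1) < n ∧ n ≤ m * (r + 1) := by
    have hpos : (0 : ℚ) < (r : ℚ) + 1 := by positivity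
    have h := Int.ceil_eq_iff.1 hm
    rw [lt_div_iff₀ hpos, div_le_iff₀ hpos] at h
    push_cast at h
    refine ⟨?_, by exact_mod_cast h.2⟩
    rcases Nat.eq_zero_or_pos m with rfl | hm0
    · simp; omega
    · have h1 := h.1
      rw [← Nat.cast_pred hm0] at h1
      exact_mod_cast h1
  -- This is where the existence of a code enters: m repair groups give m independent relations, so
  -- the dimension is at most n - m.
  have hnk : k + m ≤ n := by
    obtain ⟨F, _, _, C, hC⟩ := hLRC
    obtain ⟨Γ, -, S, hS, hT⟩ := hC.exists_repair_groups m hlow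
    have h1 := hT S subset_rfl
    have h2 := LRC.cardAddFinrank_mono C (Finset.subset_univ (S.biUnion Γ))
    rw [LRC.cardAddFinrank_univ] at h2
    omega
  -- If m ≤ 2, then k ≤ n - m ≤ m r ≤ 2r, whereas k = 3r - 2 > 2r.
  have hm3 : 3 ≤ m := by
    by_contra! hlt
    have h1 : m * (r + 1) = m * r + m := by ring
    have h2 := Nat.mul_le_mul_right r (show m ≤ 2 by omega)
    omega
  have hgreatest : IsGreatest (LRC.minDistSet n k r) (LRC.largestMinDist n k r) := by
    obtain ⟨F, hF, hF', C, hC⟩ := hLRC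
    exact LRC.isGreatest_largestMinDist ⟨_, F, hF, hF', C, hC, rfl⟩
  have hle := LRC.add_le_of_mem_minDistSet hk hr3 hm3 hlow hgreatest.1
  obtain ⟨s, hs⟩ := Nat.exists_eq_add_of_le hup
  have hn₂ : LRC.n₂ n r = s := by
    rw [LRC.n₂, hm]
    have : (m : ℤ) * (r + 1) = n + s := by exact_mod_cast hs
    omega
  have hsq : LRC.n₂ n r ≤ ⌊((LRC.n₁ n r : ℚ) ^ 2) / 4⌋ ↔ 4 * s ≤ m ^ 2 := by
    rw [Int.le_floor, hn₂, hm, le_div_iff₀ (by norm_num)]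
    push_cast
    rw [mul_comm]
    exact_mod_cast Iff.rfl
  rw [hsq, hdStar]
  constructor
  · intro hd
    have := hle.2 (by omega)
    omega
  · intro h4
    have hsr : s ≤ r := by
      have : m * (r + 1) = (m - 1) * (r + 1) + (r + 1) := by
        conv_lhs => rw [show m = m - 1 + 1 by omega]
        ring
      omega
    -- The balanced product equals ⌊m²/4⌋, by parity of m.
    have hsm : s ≤ (m / 2) * (m - m / 2) := by
      obtain ⟨c, rfl | rfl⟩ := Nat.even_or_odd' m
      · rw [show 2 * c / 2 = c by omega, show 2 * c - c = c by omega]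
        nlinarith
      · rw [show (2 * c + 1) / 2 = c by omega, show 2 * c + 1 - c = c + 1 by omega]
        have : (2 * c + 1) ^ 2 = 4 * (c * (c + 1)) + 1 := by ring
        omega
    obtain ⟨a, b, hab⟩ := LRC.exists_isBipartiteArrangement hs.symm hsr hsm
    obtain ⟨d, hd, hnd⟩ := LRC.exists_isLRC_of_isBipartiteArrangement hab hk (by omega)
    have := hgreatest.2 hd
    omega
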